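/- Causal de Finetti (bivariate). Let $(X_n,Y_n)_{n\ge 1}$ be an infinite sequence of pairs of $\{0,1\}$-valued random variables on a probability space. Write $[n]=\{1,\dots,n\}$ and $X_{[n]}=(X_1,\dots,X_n)$, $Y_{[n]}=(Y_1,\dots,Y_n)$. Assume: 1. the sequence is infinitely exchangeable: for every $N\in\mathbb N$ and every permutation $\pi$ of $[N]$, the vector $\big((X_{\pi(1)},Y_{\pi(1)}),\dots,(X_{\pi(N)},Y_{\pi(N)})\big)$ has the same law as $\big((X_1,Y_1),\dots,(X_N,Y_N)\big)$; 2. for every $n\in\mathbb N$, $Y_{[n]}\perp\!\!\!\perp X_{n+1}\mid X_{[n]}$, that is, $Y_{[n]}$ and $X_{n+1}$ are independent under $P(\,\cdot\mid X_{[n]}=x)$ for every $x\in\{0,1\}^n$ with $P(X_{[n]}=x)>0$. Then there exist a probability measure $\mu$ on $[0,1]$ and a probability measure $\nu$ on $[0,1]^2$ such that for every $N\in\mathbb N$ and all $x_1,\dots,x_N,y_1,\dots,y_N\in\{0,1\}$, $$P(X_1=x_1,Y_1=y_1,\dots,X_N=x_N,Y_N=y_N)=\int_{[0,1]^2}\int_{[0,1]}\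 \prod_{n=1}^N p(y_n\mid x_n,\psi)\,p(x_n\mid\theta)\ d\mu(\theta)\,d\nu(\psi),$$ where $p(\cdot\mid\theta)$ is the Bernoulli mass function with parameter $\theta$, i.e. $p(1\mid\theta)=\theta$ and $p(0\mid\theta)=1-\theta$, and, for $\psi=(\psi_0,\psi_1)$, $p(\cdot\mid x,\psi)$ is the Bernoulli mass function with parameter $\psi_x$, i.e. $p(1\mid x,\psi)=\psi_x$ and $p(0\mid x,\psi)=1-\psi_x$. In other words, the latent parameters $\theta\sim\mu$ and $\psi\sim\nu$ are independent. -/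

import Mathlib

open MeasureTheory ProbabilityTheory

/-- A sequence of random variables `Z 0, Z 1, …` is infinitely exchangeable under `P` if for every
`N` and every permutation `π` of the first `N` indices, `(Z (π 0), …, Z (π (N - 1)))` has the same
law as `(Z 0, …, Z (N - 1))`. -/
def InfinitelyExchangeable {Ω α : Type*} [MeasurableSpace Ω] [MeasurableSpace α]
    (P : Measure Ω) (Z : ℕ → Ω → α) : Prop :=
  ∀ (N : ℕ) (π : Equiv.Perm (Fin N)),
    IdentDistrib (fun ω (i : Fin N) => Z (π i) ω) (fun ω (i : Fin N) => Z i ω) P P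

/-- The random variables `A` and `B` are conditionally independent given the discrete random
variable `C`: they are independent under `P( · | C = c)`, for every value `c` that `C` takes with
positive probability. (No regularity of the probability space is needed for this definition,
because `C` has countably many values.) -/
def CondIndepGivenDiscrete {Ω α β γ : Type*} [MeasurableSpace Ω] [MeasurableSpace α]
    [MeasurableSpace β] [Countable γ]
    (P : Measure Ω) (A : Ω → α) (B : Ω → β) (C : Ω → γ) : Prop :=
  ∀ c : γ, P (C ⁻¹' {c}) ≠ 0 → IndepFun A B (P[|C ⁻¹' {c}])

/-- The Bernoulli mass function with success probability `p ∈ [0, 1]`. -/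
noncomputable def bernoulliMass (p : unitInterval) (z : Fin 2) : ℝ :=
  if z = 1 then (p : ℝ) else 1 - (p : ℝ)

/-! By exchangeability, the probability of a finite string depends only on its counts: `w l k` for
`l` ones and `k` zeros among the `X`'s, and `J a a' b b'` for the pairs. Marginalising the next `X`
makes `w` a Hausdorff moment array, which yields `μ`. Hypothesis 2 says that observing one more `X`
does not change the conditional law of the earlier `Y`'s (`multisetProb_mul_cons_map_fst`). So the
ratio `J / w` splits additively in `(a, a')` and in `(b, b')`, which is the consistency relation of
a moment problem on the square. Its solution is `ν`, and `J = w * (J / w)` is a product of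
integrals, so the two parameters are independent.

The moment problem is solved by `exists_isProbabilityMeasure_integral_eq`: success frequencies after
`n` trials define measures on a grid, whose moments converge because sampling with and without
replacement agree asymptotically; compactness supplies a limit. Zeros of `w` are treated separately
in `exists_measure_eq_mul_integral`. -/

/-! ### Binomial expansions and sampling without replacement -/

/-- Iterating the relation `q a b = q (a + 1) b + q a (b + 1)` gives a binomial expansion. -/
theorem eq_sum_choose_mul_of_split {q : ℕ → ℕ → ℝ}
    (hq : ∀ a b, q a b = q (a + 1) b + q a (b + 1)) (t a b : ℕ) :
    q a b = ∑ ij ∈ Finset.HasAntidiagonal.antidiagonal t, (t.choose ij.1 : ℝ) * q (a + ij.1) (b + ij.2) := by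
  induction t with
  | zero => simp
  | succ t ih =>
    rw [Finset.sum_antidiagonal_choose_succ_mul (fun i j => q (a + i) (b + j)), ih,
      ← Finset.sum_add_distrib]
    refine Finset.sum_congr rfl fun ij hij => ?_
    have h : t.choose ij.2 = t.choose ij.1 :=
      (Nat.choose_symm_of_eq_add (Finset.HasAntidiagonal.mem_antidiagonal.1 hij).symm).symm
    rw [h, hq (a + ij.1)]
    simp only [add_assoc]
    ring

/-- Condition on `i` successes in `n` trials: `k` draws without replacement are all successes with
probability `C(i,k) / C(n,k)`. Formally, expand over the remaining `n - k` trials and use `C(n,i)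
C(i,k) = C(n,k) C(n-k,i-k)`. -/
theorem moment_eq_sum_choose_div {q : ℕ → ℕ → ℝ}
    (hq : ∀ a b, q a b = q (a + 1) b + q a (b + 1)) {k n : ℕ} (hk : k ≤ n) :
    q k 0 = ∑ ij ∈ Finset.HasAntidiagonal.antidiagonal n,
      (n.choose ij.1 : ℝ) * q ij.1 ij.2 * ((ij.1.choose k : ℝ) / n.choose k) := by
  obtain ⟨t, rfl⟩ := Nat.exists_eq_add_of_le hk
  rw [eq_sum_choose_mul_of_split hq t k 0,
    Finset.Nat.sum_antidiagonal_eq_sum_range_succ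
      (fun i j => (t.choose i : ℝ) * q (k + i) (0 + j)),
    Finset.Nat.sum_antidiagonal_eq_sum_range_succ
      (fun i j => ((k + t).choose i : ℝ) * q i j * ((i.choose k : ℝ) / (k + t).choose k)),
    Nat.succ_eq_add_one, Nat.succ_eq_add_one, add_assoc k t 1, Finset.sum_range_add _ k (t + 1),
    Finset.sum_eq_zero (s := Finset.range k), zero_add]
  · refine Finset.sum_congr rfl fun i hi => ?_
    have hi' : i ≤ t := Nat.lt_succ_iff.1 (Finset.mem_range.1 hi)
    have hc : ((k + t).choose k : ℝ) ≠ 0 :=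
      Nat.cast_ne_zero.2 (Nat.choose_pos (Nat.le_add_right _ _)).ne'
    have h := Nat.choose_mul (n := k + t) (k := k + i) (s := k)
    have h' : ((k + t).choose (k + i) : ℝ) * (k + i).choose k =
        (k + t).choose k * t.choose i := by
      have e1 : k + t - k = t := by omega
      have e2 : k + i - k = i := by omega
      rw [e1, e2] at h
      exact_mod_cast h (Nat.le_add_right k i)
    have e : k + t - (k + i) = t - i := by omega
    rw [e, zero_add]
    field_simp
    linear_combination (-q (k + i) (t - i)) * h'
  · intro i hi
    simp [Nat.choose_eq_zero_of_lt (Finset.mem_range.1 hi)]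

theorem abs_mul_sub_mul_le {a b c d : ℝ} (hb : |b| ≤ 1) (hc : |c| ≤ 1) :
    |a * b - c * d| ≤ |a - c| + |b - d| := by
  have h : a * b - c * d = (a - c) * b + c * (b - d) := by ring
  rw [h]
  refine (abs_add_le _ _).trans ?_
  rw [abs_mul, abs_mul]
  exact add_le_add (mul_le_of_le_one_right (abs_nonneg _) hb)
    (mul_le_of_le_one_left (abs_nonneg _) hc)

theorem abs_choose_div_choose_le_one {n i : ℕ} (hi : i ≤ n) (k : ℕ) :
    |(i.choose k : ℝ) / n.choose k| ≤ 1 := by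
  rw [abs_of_nonneg (by positivity)]
  exact div_le_one_of_le₀ (by exact_mod_cast Nat.choose_le_choose k hi) (by positivity)

theorem abs_div_pow_le_one {n i : ℕ} (hi : i ≤ n) (k : ℕ) : |((i : ℝ) / n) ^ k| ≤ 1 := by
  rw [abs_of_nonneg (by positivity)]
  exact pow_le_one₀ (by positivity) (div_le_one_of_le₀ (by exact_mod_cast hi) (by positivity))

/-- Without replacement, the draw after `k` successes succeeds with probability `(i - k) / (n - k)`
instead of `i / n`, an error of at most `k / (n - k)`. These errors add up, and `k ^ 2 + k ≤ (k + 1)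
^ 2`. -/
theorem abs_choose_div_choose_sub_pow_le {n i : ℕ} (hi : i ≤ n) (k : ℕ) (hk : k < n) :
    |(i.choose k : ℝ) / n.choose k - ((i : ℝ) / n) ^ k| ≤ (k : ℝ) ^ 2 / ((n : ℝ) - k) := by
  induction k with
  | zero => simp
  | succ k ih =>
    have hkn : k < n := by omega
    have hkn' : (k : ℝ) + 1 < n := by exact_mod_cast hk
    have hpos : (0 : ℝ) < (n : ℝ) - k := by linarith
    have hn : (0 : ℝ) < n := by have := Nat.cast_nonneg (α := ℝ) k; linarith
    have hcn : (n.choose k : ℝ) ≠ 0 := Nat.cast_ne_zero.2 (Nat.choose_pos hkn.le).ne'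
    have hcn' : (n.choose (k + 1) : ℝ) ≠ 0 := Nat.cast_ne_zero.2 (Nat.choose_pos hk.le).ne'
    have hsub : ((n - k : ℕ) : ℝ) = n - k := Nat.cast_sub hkn.le
    have hN : (n.choose (k + 1) : ℝ) * (k + 1) = n.choose k * ((n : ℝ) - k) := by
      rw [← hsub]; exact_mod_cast Nat.choose_succ_right_eq n k
    have hI : (i.choose (k + 1) : ℝ) * (k + 1) = i.choose k * ((i - k : ℕ) : ℝ) := by
      exact_mod_cast Nat.choose_succ_right_eq i k
    have hstep : (i.choose (k + 1) : ℝ) / n.choose (k + 1) =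
        (i.choose k : ℝ) / n.choose k * (((i - k : ℕ) : ℝ) / (n - k)) := by
      rw [div_mul_div_comm, ← hI, ← hN]
      field_simp
    have hratio : |((i - k : ℕ) : ℝ) / (n - k) - (i : ℝ) / n| ≤ k / ((n : ℝ) - k) := by
      have hin : (i : ℝ) ≤ n := by exact_mod_cast hi
      have hk0 : (0 : ℝ) ≤ k := Nat.cast_nonneg k
      have hi0 : (0 : ℝ) ≤ i := Nat.cast_nonneg i
      rcases le_total k i with hki | hik
      · rw [Nat.cast_sub hki]
        have : ((i : ℝ) - k) / (n - k) - (i : ℝ) / n = -(k * (n - i) / (n * (n - k))) := by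
          field_simp
          ring
        rw [this, abs_neg, abs_of_nonneg
          (div_nonneg (mul_nonneg hk0 (sub_nonneg.2 hin)) (by positivity)),
          div_le_div_iff₀ (by positivity) hpos]
        nlinarith [mul_nonneg (mul_nonneg hk0 hi0) hpos.le]
      -- The truncated difference `i - k` is zero, so only `i / n` has to be bounded.
      · have hik' : (i : ℝ) ≤ k := by exact_mod_cast hik
        rw [Nat.sub_eq_zero_of_le hik, Nat.cast_zero, zero_div, zero_sub, abs_neg,
          abs_of_nonneg (by positivity), div_le_div_iff₀ hn hpos]
        nlinarith
    have hratio1 : |((i - k : ℕ) : ℝ) / (n - k)| ≤ 1 := by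
      rw [← hsub, abs_of_nonneg (by positivity)]
      exact div_le_one_of_le₀ (by exact_mod_cast Nat.sub_le_sub_right hi k) (by positivity)
    rw [hstep, pow_succ]
    refine (abs_mul_sub_mul_le hratio1 (abs_div_pow_le_one hi k)).trans ?_
    refine (add_le_add (ih hkn) hratio).trans ?_
    rw [← add_div]
    push_cast
    have hk0 : (0 : ℝ) ≤ k := Nat.cast_nonneg k
    exact div_le_div₀ (by positivity) (by nlinarith) (by linarith) (by linarith)

open Filter Topology in
theorem tendsto_sq_div_natCast_sub (k : ℕ) :
    Tendsto (fun n : ℕ => (k : ℝ) ^ 2 / ((n : ℝ) - k)) atTop (𝓝 0) :=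
  Tendsto.div_atTop tendsto_const_nhds
    (tendsto_atTop_add_const_right _ _ tendsto_natCast_atTop_atTop)

/-! ### The Hausdorff moment problem on the square -/

theorem integrable_of_continuous {ν : Measure (Fin 2 → unitInterval)} [IsFiniteMeasure ν]
    {f : (Fin 2 → unitInterval) → ℝ} (hf : Continuous f) : Integrable f ν :=
  integrableOn_univ.1 (hf.continuousOn.integrableOn_compact isCompact_univ)

/-- The discrete measure on the square whose mass at `(i / n, j / n)` is the probability, prescribed
by `p`, of `i` successes and `j` successes among `n` trials of each of the two kinds. -/
noncomputable def gridMeasure (p : ℕ → ℕ → ℕ → ℕ → ℝ) (n : ℕ) : Measure (Fin 2 → unitInterval) :=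
  ∑ s ∈ Finset.HasAntidiagonal.antidiagonal n ×ˢ Finset.HasAntidiagonal.antidiagonal n,
    ENNReal.ofReal ((n.choose s.1.1 : ℝ) * ((n.choose s.2.1 : ℝ) * p s.1.1 s.1.2 s.2.1 s.2.2)) •
      Measure.dirac ![Set.projIcc 0 1 zero_le_one ((s.1.1 : ℝ) / n),
        Set.projIcc 0 1 zero_le_one ((s.2.1 : ℝ) / n)]

section Moments

variable {p : ℕ → ℕ → ℕ → ℕ → ℝ}

theorem moment_eq_sum_choose_div₂
    (hx : ∀ a a' b b', p a a' b b' = p (a + 1) a' b b' + p a (a' + 1) b b')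
    (hy : ∀ a a' b b', p a a' b b' = p a a' (b + 1) b' + p a a' b (b' + 1))
    {k l n : ℕ} (hk : k ≤ n) (hl : l ≤ n) :
    p k 0 l 0 = ∑ s ∈ Finset.HasAntidiagonal.antidiagonal n ×ˢ Finset.HasAntidiagonal.antidiagonal n,
      ((n.choose s.1.1 : ℝ) * ((n.choose s.2.1 : ℝ) * p s.1.1 s.1.2 s.2.1 s.2.2)) *
        (((s.1.1.choose k : ℝ) / n.choose k) * ((s.2.1.choose l : ℝ) / n.choose l)) := by
  rw [Finset.sum_product, moment_eq_sum_choose_div (q := fun a a' => p a a' l 0)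
    (fun a a' => hx a a' l 0) hk]
  refine Finset.sum_congr rfl fun ij _ => ?_
  rw [moment_eq_sum_choose_div (q := fun b b' => p ij.1 ij.2 b b') (hy ij.1 ij.2) hl,
    Finset.mul_sum, Finset.sum_mul]
  refine Finset.sum_congr rfl fun ij' _ => ?_
  ring

theorem integral_gridMeasure (h0 : ∀ a a' b b', 0 ≤ p a a' b b') (n k l : ℕ) :
    ∫ ψ, ((ψ 0 : unitInterval) : ℝ) ^ k * ((ψ 1 : unitInterval) : ℝ) ^ l ∂(gridMeasure p n) =
      ∑ s ∈ Finset.HasAntidiagonal.antidiagonal n ×ˢ Finset.HasAntidiagonal.antidiagonal n,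
        ((n.choose s.1.1 : ℝ) * ((n.choose s.2.1 : ℝ) * p s.1.1 s.1.2 s.2.1 s.2.2)) *
          (((s.1.1 : ℝ) / n) ^ k * ((s.2.1 : ℝ) / n) ^ l) := by
  have hcont : Continuous fun ψ : Fin 2 → unitInterval =>
    ((ψ 0 : unitInterval) : ℝ) ^ k * ((ψ 1 : unitInterval) : ℝ) ^ l := by fun_prop
  rw [gridMeasure, integral_finsetSum_measure]
  · refine Finset.sum_congr rfl fun s hs => ?_
    obtain ⟨h1, h2⟩ := Finset.mem_product.1 hs
    have mem : ∀ u ∈ Finset.HasAntidiagonal.antidiagonal n, ((u.1 : ℝ) / n) ∈ Set.Icc (0 : ℝ) 1 := by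
      intro u hu
      have : u.1 ≤ n := Nat.le.intro (Finset.HasAntidiagonal.mem_antidiagonal.1 hu)
      exact ⟨by positivity, div_le_one_of_le₀ (by exact_mod_cast this) (by positivity)⟩
    have hw : 0 ≤ (n.choose s.1.1 : ℝ) * ((n.choose s.2.1 : ℝ) * p s.1.1 s.1.2 s.2.1 s.2.2) :=
      mul_nonneg (Nat.cast_nonneg _) (mul_nonneg (Nat.cast_nonneg _) (h0 _ _ _ _))
    rw [integral_smul_measure, integral_dirac, ENNReal.toReal_ofReal hw, smul_eq_mul]
    simp [Set.projIcc_of_mem _ (mem _ h1), Set.projIcc_of_mem _ (mem _ h2)]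
  · intro s _
    exact (integrable_of_continuous hcont).smul_measure ENNReal.ofReal_ne_top

theorem isProbabilityMeasure_gridMeasure (h0 : ∀ a a' b b', 0 ≤ p a a' b b')
    (h1 : p 0 0 0 0 = 1)
    (hx : ∀ a a' b b', p a a' b b' = p (a + 1) a' b b' + p a (a' + 1) b b')
    (hy : ∀ a a' b b', p a a' b b' = p a a' (b + 1) b' + p a a' b (b' + 1)) (n : ℕ) :
    IsProbabilityMeasure (gridMeasure p n) := by
  constructor
  have h := moment_eq_sum_choose_div₂ hx hy (Nat.zero_le n) (Nat.zero_le n)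
  simp only [Nat.choose_zero_right, Nat.cast_one, div_one, mul_one, h1] at h
  rw [gridMeasure]
  simp only [Measure.coe_finsetSum, Finset.sum_apply, Measure.smul_apply, measure_univ,
    smul_eq_mul, mul_one]
  rw [← ENNReal.ofReal_sum_of_nonneg, ← h, ENNReal.ofReal_one]
  exact fun s _ => mul_nonneg (Nat.cast_nonneg _) (mul_nonneg (Nat.cast_nonneg _) (h0 _ _ _ _))

open Filter Topology in
theorem tendsto_integral_gridMeasure (h0 : ∀ a a' b b', 0 ≤ p a a' b b')
    (h1 : p 0 0 0 0 = 1)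
    (hx : ∀ a a' b b', p a a' b b' = p (a + 1) a' b b' + p a (a' + 1) b b')
    (hy : ∀ a a' b b', p a a' b b' = p a a' (b + 1) b' + p a a' b (b' + 1)) (k l : ℕ) :
    Tendsto (fun n => ∫ ψ, ((ψ 0 : unitInterval) : ℝ) ^ k * ((ψ 1 : unitInterval) : ℝ) ^ l
      ∂(gridMeasure p n)) atTop (𝓝 (p k 0 l 0)) := by
  rw [tendsto_iff_dist_tendsto_zero]
  refine squeeze_zero' (Eventually.of_forall fun _ => dist_nonneg) ?_
    (by simpa using (tendsto_sq_div_natCast_sub k).add (tendsto_sq_div_natCast_sub l))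
  filter_upwards [eventually_gt_atTop k, eventually_gt_atTop l] with n hk hl
  have hone := moment_eq_sum_choose_div₂ hx hy (Nat.zero_le n) (Nat.zero_le n)
  simp only [Nat.choose_zero_right, Nat.cast_one, div_one, mul_one, h1] at hone
  rw [integral_gridMeasure h0, moment_eq_sum_choose_div₂ hx hy hk.le hl.le, Real.dist_eq,
    ← Finset.sum_sub_distrib]
  refine (Finset.abs_sum_le_sum_abs _ _).trans ?_
  -- The factor one is written as the total mass of the weights, so that the bound can be checked at
  -- each grid point.
  rw [← one_mul ((k : ℝ) ^ 2 / ((n : ℝ) - k) + (l : ℝ) ^ 2 / ((n : ℝ) - l)), hone, Finset.sum_mul]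
  refine Finset.sum_le_sum fun s hs => ?_
  obtain ⟨hs1, hs2⟩ := Finset.mem_product.1 hs
  have hs1 : s.1.1 ≤ n := Nat.le.intro (Finset.HasAntidiagonal.mem_antidiagonal.1 hs1)
  have hs2 : s.2.1 ≤ n := Nat.le.intro (Finset.HasAntidiagonal.mem_antidiagonal.1 hs2)
  have hw : 0 ≤ (n.choose s.1.1 : ℝ) * ((n.choose s.2.1 : ℝ) * p s.1.1 s.1.2 s.2.1 s.2.2) :=
    mul_nonneg (Nat.cast_nonneg _) (mul_nonneg (Nat.cast_nonneg _) (h0 _ _ _ _))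
  rw [← mul_sub, abs_mul, abs_of_nonneg hw, abs_sub_comm]
  refine mul_le_mul_of_nonneg_left ?_ hw
  exact (abs_mul_sub_mul_le (abs_choose_div_choose_le_one hs2 l) (abs_div_pow_le_one hs1 k)).trans
    (add_le_add (abs_choose_div_choose_sub_pow_le hs1 k hk)
      (abs_choose_div_choose_sub_pow_le hs2 l hl))

open Filter Topology in
/-- **Hausdorff moment problem on the square.** -/
theorem exists_isProbabilityMeasure_integral_eq (h0 : ∀ a a' b b', 0 ≤ p a a' b b')
    (h1 : p 0 0 0 0 = 1)
    (hx : ∀ a a' b b', p a a' b b' = p (a + 1) a' b b' + p a (a' + 1) b b')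
    (hy : ∀ a a' b b', p a a' b b' = p a a' (b + 1) b' + p a a' b (b' + 1)) :
    ∃ ν : Measure (Fin 2 → unitInterval), IsProbabilityMeasure ν ∧ ∀ a a' b b',
      ∫ ψ, ((ψ 0 : unitInterval) : ℝ) ^ a * (1 - ((ψ 0 : unitInterval) : ℝ)) ^ a' *
        (((ψ 1 : unitInterval) : ℝ) ^ b * (1 - ((ψ 1 : unitInterval) : ℝ)) ^ b') ∂ν =
        p a a' b b' := by
  let G : ℕ → ProbabilityMeasure (Fin 2 → unitInterval) := fun n =>
    ⟨gridMeasure p n, isProbabilityMeasure_gridMeasure h0 h1 hx hy n⟩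
  -- Probability measures on a compact metrizable space form a compact space, so the grid measures
  -- converge along a free ultrafilter.
  let U : Ultrafilter (ProbabilityMeasure (Fin 2 → unitInterval)) := (hyperfilter ℕ).map G
  obtain ⟨ν, -, hν⟩ := isCompact_univ.ultrafilter_le_nhds U (by simp)
  have hG : Tendsto G (hyperfilter ℕ) (𝓝 ν) := hν
  refine ⟨ν, inferInstance, ?_⟩
  have hmom : ∀ k l, ∫ ψ, ((ψ 0 : unitInterval) : ℝ) ^ k * ((ψ 1 : unitInterval) : ℝ) ^ l
      ∂(ν : Measure (Fin 2 → unitInterval)) = p k 0 l 0 := by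
    intro k l
    have hcont : Continuous fun ψ : Fin 2 → unitInterval =>
      ((ψ 0 : unitInterval) : ℝ) ^ k * ((ψ 1 : unitInterval) : ℝ) ^ l := by fun_prop
    have hlim := (ProbabilityMeasure.tendsto_iff_forall_integral_tendsto.1 hG)
      (BoundedContinuousFunction.mkOfCompact ⟨_, hcont⟩)
    exact tendsto_nhds_unique hlim
      ((tendsto_integral_gridMeasure h0 h1 hx hy k l).mono_left Nat.hyperfilter_le_atTop)
  -- Factors `1 - ψ` come from differences: `x^b (1-x)^(b'+1) = x^b (1-x)^b' - x^(b+1) (1-x)^b'`,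
  -- matched by the splitting relation for `p`.
  have hmom' : ∀ b' a b, ∫ ψ, ((ψ 0 : unitInterval) : ℝ) ^ a * (((ψ 1 : unitInterval) : ℝ) ^ b *
      (1 - ((ψ 1 : unitInterval) : ℝ)) ^ b') ∂(ν : Measure (Fin 2 → unitInterval)) =
        p a 0 b b' := by
    intro b'
    induction b' with
    | zero => intro a b; simpa using hmom a b
    | succ b' ih =>
      intro a b
      rw [eq_sub_of_add_eq' (hy a 0 b b').symm, ← ih a b, ← ih a (b + 1), ← integral_sub]
      · congr 1
        ext ψ
        ring
      all_goals exact integrable_of_continuous (by fun_prop)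
  intro a a'
  induction a' generalizing a with
  | zero => intro b b'; simpa using hmom' b' a b
  | succ a' ih =>
    intro b b'
    rw [eq_sub_of_add_eq' (hx a a' b b').symm, ← ih a b, ← ih (a + 1) b, ← integral_sub]
    · congr 1
      ext ψ
      ring
    all_goals exact integrable_of_continuous (by fun_prop)

end Moments

/-! ### Exchangeable laws as functions of multisets -/

/-- The probability that the first `card s` terms of the sequence `Z` are the elements of `s`, in
some fixed order. -/
noncomputable def multisetProb {Ω α : Type*} [MeasurableSpace Ω] (P : Measure Ω) (Z : ℕ → Ω → α)
    (s : Multiset α) : ℝ :=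
  P.real {ω | ∀ n : Fin s.toList.length, Z n ω = s.toList.get n}

theorem multisetProb_nonneg {Ω α : Type*} [MeasurableSpace Ω] (P : Measure Ω) (Z : ℕ → Ω → α)
    (s : Multiset α) : 0 ≤ multisetProb P Z s := measureReal_nonneg

theorem multisetProb_zero {Ω α : Type*} [MeasurableSpace Ω] (P : Measure Ω) (Z : ℕ → Ω → α)
    [IsProbabilityMeasure P] : multisetProb P Z 0 = 1 := by
  have : IsEmpty (Fin (0 : Multiset α).toList.length) := by simp; infer_instance
  simp [multisetProb]

/-- Equal multisets give fibres of equal size over each value; bijections between the fibres glue to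
a permutation. -/
theorem exists_perm_of_coe_ofFn_eq {α : Type*} {N : ℕ} {z w : Fin N → α}
    (h : (List.ofFn z : Multiset α) = List.ofFn w) : ∃ π : Equiv.Perm (Fin N), z = w ∘ π := by
  classical
  have hcard : ∀ a, Fintype.card {i // z i = a} = Fintype.card {i // w i = a} := by
    intro a
    have h' := congrArg (Multiset.count a) h
    rw [← Fin.univ_val_map, ← Fin.univ_val_map, Multiset.count_map, Multiset.count_map] at h'
    rw [Fintype.card_subtype, Fintype.card_subtype]
    simpa [Finset.card, eq_comm] using h'
  refine ⟨Equiv.ofFiberEquiv fun a => Fintype.equivOfCardEq (hcard a), ?_⟩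
  ext i
  exact (Equiv.ofFiberEquiv_map _ i).symm

theorem coe_ofFn_snoc {α : Type*} {N : ℕ} (z : Fin N → α) (a : α) :
    (List.ofFn (Fin.snoc z a : Fin (N + 1) → α) : Multiset α) = a ::ₘ (List.ofFn z : Multiset α) := by
  rw [List.ofFn_succ']
  simp [← Multiset.coe_add, add_comm, ← Multiset.singleton_add]

theorem exists_coe_ofFn_eq {α : Type*} (s : Multiset α) :
    ∃ (N : ℕ) (z : Fin N → α), (List.ofFn z : Multiset α) = s :=
  ⟨_, s.toList.get, by rw [List.ofFn_get, Multiset.coe_toList]⟩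

theorem forall_fin_succ_eq_snoc {α Ω : Type*} (Z : ℕ → Ω → α) {N : ℕ} (z : Fin N → α) (a : α)
    (ω : Ω) : (∀ n : Fin (N + 1), Z n ω = (Fin.snoc z a : Fin (N + 1) → α) n) ↔
      (∀ n : Fin N, Z n ω = z n) ∧ Z N ω = a := by
  rw [Fin.forall_fin_succ']
  simp

section Exchangeable

variable {Ω α : Type*} [MeasurableSpace Ω] [MeasurableSpace α] {P : Measure Ω} {Z : ℕ → Ω → α}

theorem measurableSet_forall_eq [MeasurableSingletonClass α] (hZ : ∀ n, Measurable (Z n)) {N : ℕ}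
    (z : Fin N → α) : MeasurableSet {ω | ∀ n : Fin N, Z n ω = z n} := by
  rw [Set.ofPred_forall]
  exact MeasurableSet.iInter fun n => hZ n (measurableSet_singleton (z n))

theorem InfinitelyExchangeable.comp {β : Type*} [MeasurableSpace β] {f : α → β}
    (h : InfinitelyExchangeable P Z) (hf : Measurable f) :
    InfinitelyExchangeable P (fun n ω => f (Z n ω)) := fun N π =>
  (h N π).comp (u := fun (z : Fin N → α) i => f (z i)) (by fun_prop)

variable [MeasurableSingletonClass α]

theorem InfinitelyExchangeable.measureReal_comp_perm (h : InfinitelyExchangeable P Z) {N : ℕ}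
    (z : Fin N → α) (π : Equiv.Perm (Fin N)) :
    P.real {ω | ∀ n : Fin N, Z n ω = (z ∘ π) n} = P.real {ω | ∀ n : Fin N, Z n ω = z n} := by
  have h' := (h N π).measure_mem_eq (measurableSet_singleton (z ∘ π))
  have e1 : (fun ω (i : Fin N) => Z (π i) ω) ⁻¹' {z ∘ π} = {ω | ∀ n : Fin N, Z n ω = z n} := by
    ext ω
    simp only [Set.mem_preimage, Set.mem_singleton_iff, funext_iff, Function.comp_apply,
      Set.mem_ofPred_eq]
    exact π.forall_congr_right (q := fun i : Fin N => Z i ω = z i)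
  have e2 : (fun ω (i : Fin N) => Z i ω) ⁻¹' {z ∘ π} =
      {ω | ∀ n : Fin N, Z n ω = (z ∘ π) n} := by
    ext ω
    simp [funext_iff]
  rw [e1, e2] at h'
  rw [Measure.real, Measure.real, h']

theorem InfinitelyExchangeable.measureReal_eq_multisetProb (h : InfinitelyExchangeable P Z) {N : ℕ}
    (z : Fin N → α) :
    P.real {ω | ∀ n : Fin N, Z n ω = z n} = multisetProb P Z (List.ofFn z) := by
  -- The length `M` is kept free so that it can be identified with `N`; the length of `toList` is
  -- not syntactically `N`.
  have key : ∀ (M : ℕ) (w : Fin M → α), (List.ofFn z : Multiset α) = List.ofFn w →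
      P.real {ω | ∀ n : Fin N, Z n ω = z n} = P.real {ω | ∀ n : Fin M, Z n ω = w n} := by
    intro M w hzw
    obtain rfl : N = M := by simpa using congrArg Multiset.card hzw
    obtain ⟨π, rfl⟩ := exists_perm_of_coe_ofFn_eq hzw
    exact h.measureReal_comp_perm w π
  exact key _ _ (by rw [List.ofFn_get, Multiset.coe_toList])

theorem InfinitelyExchangeable.multisetProb_eq_sum_cons [Fintype α] [IsFiniteMeasure P]
    (h : InfinitelyExchangeable P Z) (hZ : ∀ n, Measurable (Z n)) (s : Multiset α) :
    multisetProb P Z s = ∑ a, multisetProb P Z (a ::ₘ s) := by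
  obtain ⟨N, z, rfl⟩ := exists_coe_ofFn_eq s
  simp_rw [← coe_ofFn_snoc, ← h.measureReal_eq_multisetProb]
  rw [← measureReal_biUnion_finset]
  · congr 1
    ext ω
    simp [Fin.forall_fin_succ']
  · intro a _ b _ hab
    refine Set.disjoint_left.2 fun ω ha hb => hab ?_
    exact ((forall_fin_succ_eq_snoc Z z a ω).1 ha).2.symm.trans
      ((forall_fin_succ_eq_snoc Z z b ω).1 hb).2
  · exact fun a _ => measurableSet_forall_eq hZ _

end Exchangeable

/-! ### Conditional independence in terms of counts -/

section Pairs

variable {Ω α β : Type*} [MeasurableSpace Ω] [MeasurableSpace α] [MeasurableSpace β]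
  [MeasurableSingletonClass α] [MeasurableSingletonClass β] {P : Measure Ω}
  {X : ℕ → Ω → α} {Y : ℕ → Ω → β}

theorem multisetProb_le_map_fst [IsFiniteMeasure P]
    (h : InfinitelyExchangeable P fun n ω => (X n ω, Y n ω)) (s : Multiset (α × β)) :
    multisetProb P (fun n ω => (X n ω, Y n ω)) s ≤ multisetProb P X (s.map Prod.fst) := by
  obtain ⟨N, z, rfl⟩ := exists_coe_ofFn_eq s
  rw [Multiset.map_coe, List.map_ofFn, ← (h.comp measurable_fst).measureReal_eq_multisetProb,
    ← h.measureReal_eq_multisetProb]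
  exact measureReal_mono fun ω hω n => congrArg Prod.fst (hω n)

/-- Given `X 0, …, X (N - 1)`, appending `X N` does not change the law of `Y 0, …, Y (N - 1)`. -/
theorem multisetProb_mul_cons_map_fst [Fintype α] [Fintype β] [IsProbabilityMeasure P]
    (hX : ∀ n, Measurable (X n)) (hY : ∀ n, Measurable (Y n))
    (h : InfinitelyExchangeable P fun n ω => (X n ω, Y n ω))
    (hindep : ∀ n : ℕ, CondIndepGivenDiscrete P
      (fun ω (i : Fin n) => Y i ω) (X n) (fun ω (i : Fin n) => X i ω))
    (s : Multiset (α × β)) (a : α) :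
    multisetProb P (fun n ω => (X n ω, Y n ω)) s * multisetProb P X (a ::ₘ s.map Prod.fst) =
      multisetProb P X (s.map Prod.fst) *
        ∑ b, multisetProb P (fun n ω => (X n ω, Y n ω)) ((a, b) ::ₘ s) := by
  obtain ⟨N, z, rfl⟩ := exists_coe_ofFn_eq s
  have hXe : InfinitelyExchangeable P X := h.comp measurable_fst
  have hZ : ∀ n, Measurable fun ω => (X n ω, Y n ω) := fun n => (hX n).prodMk (hY n)
  rw [Multiset.map_coe, List.map_ofFn]
  simp_rw [← coe_ofFn_snoc, ← hXe.measureReal_eq_multisetProb, ← h.measureReal_eq_multisetProb]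
  set C : Set Ω := (fun ω (i : Fin N) => X i ω) ⁻¹' {Prod.fst ∘ z} with hC
  set A : Set Ω := (fun ω (i : Fin N) => Y i ω) ⁻¹' {Prod.snd ∘ z} with hA
  set B : Set Ω := X N ⁻¹' {a} with hB
  have hCm : MeasurableSet C :=
    (measurable_pi_lambda _ fun i : Fin N => hX i) (measurableSet_singleton _)
  have e1 : {ω | ∀ n : Fin N, (X n ω, Y n ω) = z n} = C ∩ A := by
    ext ω
    simp [hC, hA, funext_iff, Prod.ext_iff, forall_and]
  have e2 : {ω | ∀ n : Fin N, X n ω = (Prod.fst ∘ z) n} = C := by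
    ext ω
    simp [hC, funext_iff]
  have e3 : {ω | ∀ n : Fin (N + 1), X n ω = (Fin.snoc (Prod.fst ∘ z) a : Fin (N + 1) → α) n} =
      C ∩ B := by
    ext ω
    rw [Set.mem_ofPred_eq, forall_fin_succ_eq_snoc]
    simp [hC, hB, funext_iff]
  -- Summing over `b` forgets the value of `Y N`, leaving only the event `X N = a`.
  have e4 : ∑ b, P.real {ω | ∀ n : Fin (N + 1),
      (X n ω, Y n ω) = (Fin.snoc z (a, b) : Fin (N + 1) → α × β) n} = P.real (C ∩ (A ∩ B)) := by
    rw [← measureReal_biUnion_finset]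
    · congr 1
      rw [← Set.inter_assoc, ← e1]
      ext ω
      simp [Fin.forall_fin_succ', hB, Prod.ext_iff]
    · intro b _ b' _ hb
      refine Set.disjoint_left.2 fun ω h1 h2 => hb ?_
      have h1' := ((forall_fin_succ_eq_snoc (fun n ω => (X n ω, Y n ω)) z (a, b) ω).1 h1).2
      have h2' := ((forall_fin_succ_eq_snoc (fun n ω => (X n ω, Y n ω)) z (a, b') ω).1 h2).2
      exact congrArg Prod.snd (h1'.symm.trans h2')
    · exact fun b _ => measurableSet_forall_eq hZ _
  rw [e1, e2, e3, e4]
  by_cases hP : P C = 0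
  · have h0 : ∀ S, P.real (C ∩ S) = 0 := fun S => by
      rw [Measure.real, measure_inter_null_of_null_left _ hP, ENNReal.toReal_zero]
    rw [h0, h0, h0, zero_mul, mul_zero]
  · have hi := (hindep N _ hP).measure_inter_preimage_eq_mul {Prod.snd ∘ z} {a}
      (measurableSet_singleton _) (measurableSet_singleton _)
    have hi' : P[|C].real (A ∩ B) = P[|C].real A * P[|C].real B := by
      rw [Measure.real, hi, ENNReal.toReal_mul]
      rfl
    have hc : ∀ S, P.real (C ∩ S) = P[|C].real S * P.real C := fun S => by
      rw [Measure.real, ← cond_mul_eq_inter hCm, ENNReal.toReal_mul]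
      rfl
    rw [hc, hc, hc, hi']
    ring

end Pairs

/-! ### Factoring the joint law through the law of the first coordinates -/

/-- **Hausdorff moment problem on the unit interval.** -/
theorem exists_isProbabilityMeasure_integral_unitInterval_eq {w : ℕ → ℕ → ℝ}
    (h0 : ∀ a b, 0 ≤ w a b) (h1 : w 0 0 = 1) (hw : ∀ a b, w a b = w (a + 1) b + w a (b + 1)) :
    ∃ μ : Measure unitInterval, IsProbabilityMeasure μ ∧
      ∀ a b, ∫ θ, (θ : ℝ) ^ a * (1 - (θ : ℝ)) ^ b ∂μ = w a b := by
  -- The second kind of trial is made to succeed always, and the first marginal of the resulting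
  -- measure is taken.
  obtain ⟨ν, hν, h⟩ := exists_isProbabilityMeasure_integral_eq
    (p := fun a a' _ b' => w a a' * if b' = 0 then 1 else 0)
    (fun a a' _ b' => mul_nonneg (h0 a a') (by split_ifs <;> norm_num)) (by simp [h1])
    (fun a a' b b' => by rw [hw a a', add_mul]) (fun a a' b b' => by simp)
  have hm : AEMeasurable (fun ψ : Fin 2 → unitInterval => ψ 0) ν :=
    (measurable_pi_apply 0).aemeasurable
  refine ⟨ν.map (fun ψ => ψ 0), Measure.isProbabilityMeasure_map hm, fun a b => ?_⟩
  rw [integral_map hm (Continuous.aestronglyMeasurable (by fun_prop))]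
  simpa using h a b 0 0

/-- A nonnegative integrand with zero integral vanishes almost everywhere, and the zero set of `θ^a
(1-θ)^b` depends only on which exponents are nonzero. -/
theorem integral_pow_mul_pow_eq_zero {μ : Measure unitInterval} [IsFiniteMeasure μ]
    {a b a' b' : ℕ} (h : ∫ θ, (θ : ℝ) ^ a * (1 - (θ : ℝ)) ^ b ∂μ = 0)
    (ha : a ≠ 0 → a' ≠ 0) (hb : b ≠ 0 → b' ≠ 0) :
    ∫ θ, (θ : ℝ) ^ a' * (1 - (θ : ℝ)) ^ b' ∂μ = 0 := by
  have hint : Integrable (fun θ : unitInterval => (θ : ℝ) ^ a * (1 - (θ : ℝ)) ^ b) μ :=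
    integrableOn_univ.1 (Continuous.continuousOn (by fun_prop)
      |>.integrableOn_compact isCompact_univ)
  rw [integral_eq_zero_iff_of_nonneg (fun θ => mul_nonneg (pow_nonneg θ.2.1 _)
    (pow_nonneg (sub_nonneg.2 θ.2.2) _)) hint] at h
  refine integral_eq_zero_of_ae ?_
  filter_upwards [h] with θ hθ
  simp only [Pi.zero_apply, mul_eq_zero, pow_eq_zero_iff'] at hθ ⊢
  tauto

/-- A law for a binary sequence whose mass functions are the ratios `j a a' / v (a + a')`, with a
default choice when these are undefined. -/
theorem exists_split_mul_eq {j : ℕ → ℕ → ℝ} {v : ℕ → ℝ} (hj0 : ∀ a a', 0 ≤ j a a')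
    (hj1 : j 0 0 = 1) (hv1 : v 0 = 1) (hjv : ∀ a a', j a a' ≤ v (a + a'))
    (hj : ∀ a a', j a a' * v (a + a' + 1) = v (a + a') * (j (a + 1) a' + j a (a' + 1)))
    (hv : ∀ n m, v n = 0 → m ≠ 0 → v m = 0) :
    ∃ q : ℕ → ℕ → ℝ, (∀ a a', 0 ≤ q a a') ∧ q 0 0 = 1 ∧
      (∀ a a', q a a' = q (a + 1) a' + q a (a' + 1)) ∧ ∀ a a', j a a' = v (a + a') * q a a' := by
  by_cases h : ∃ n, v n = 0
  · obtain ⟨n, hn⟩ := h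
    -- Since `v 0 = 1`, a single zero of `v` forces `v` to vanish at every positive argument. Only
    -- `q 0 0` is then constrained, and the law of constant success serves as default.
    refine ⟨fun _ a' => if a' = 0 then 1 else 0, fun _ a' => by positivity, by simp,
      fun a a' => by simp, fun a a' => ?_⟩
    by_cases h0 : a + a' = 0
    · obtain ⟨rfl, rfl⟩ := Nat.add_eq_zero_iff.1 h0
      simp [hj1, hv1]
    · have hz := hv n _ hn h0
      rw [hz, zero_mul]
      exact le_antisymm (hz ▸ hjv a a') (hj0 a a')
  · have hne : ∀ n, v n ≠ 0 := fun n hn => h ⟨n, hn⟩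
    have hv0 : ∀ n, 0 ≤ v n := fun n => (hj0 n 0).trans (hjv n 0)
    refine ⟨fun a a' => j a a' / v (a + a'), fun a a' => div_nonneg (hj0 _ _) (hv0 _),
      by simp [hj1, hv1], fun a a' => ?_, fun a a' => (mul_div_cancel₀ _ (hne _)).symm⟩
    beta_reduce
    rw [show a + 1 + a' = a + a' + 1 by ring, show a + (a' + 1) = a + a' + 1 by ring, ← add_div,
      div_eq_div_iff (hne _) (hne _), hj a a']
    ring

/-- If the joint masses `J` have marginal masses `w`, and the conditional masses `J / w` do not
depend on further values of the first coordinates, then they are mixtures of products. -/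
theorem exists_measure_eq_mul_integral {J : ℕ → ℕ → ℕ → ℕ → ℝ} {w : ℕ → ℕ → ℝ}
    (hJ0 : ∀ a a' b b', 0 ≤ J a a' b b') (hJ1 : J 0 0 0 0 = 1) (hw1 : w 0 0 = 1)
    (hJw : ∀ a a' b b', J a a' b b' ≤ w (b + b') (a + a'))
    (hx : ∀ a a' b b', J a a' b b' * w (b + b') (a + a' + 1) =
      w (b + b') (a + a') * (J (a + 1) a' b b' + J a (a' + 1) b b'))
    (hy : ∀ a a' b b', J a a' b b' * w (b + b' + 1) (a + a') =
      w (b + b') (a + a') * (J a a' (b + 1) b' + J a a' b (b' + 1)))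
    (hw : ∀ a b a' b', w a b = 0 → (a ≠ 0 → a' ≠ 0) → (b ≠ 0 → b' ≠ 0) → w a' b' = 0) :
    ∃ ν : Measure (Fin 2 → unitInterval), IsProbabilityMeasure ν ∧ ∀ a a' b b',
      J a a' b b' = w (b + b') (a + a') *
        ∫ ψ, ((ψ 0 : unitInterval) : ℝ) ^ a * (1 - ((ψ 0 : unitInterval) : ℝ)) ^ a' *
          (((ψ 1 : unitInterval) : ℝ) ^ b * (1 - ((ψ 1 : unitInterval) : ℝ)) ^ b') ∂ν := by
  suffices H : ∃ p : ℕ → ℕ → ℕ → ℕ → ℝ, (∀ a a' b b', 0 ≤ p a a' b b') ∧ p 0 0 0 0 = 1 ∧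
      (∀ a a' b b', p a a' b b' = p (a + 1) a' b b' + p a (a' + 1) b b') ∧
      (∀ a a' b b', p a a' b b' = p a a' (b + 1) b' + p a a' b (b' + 1)) ∧
      ∀ a a' b b', J a a' b b' = w (b + b') (a + a') * p a a' b b' by
    obtain ⟨p, p0, p1, px, py, hp⟩ := H
    obtain ⟨ν, hν, h⟩ := exists_isProbabilityMeasure_integral_eq p0 p1 px py
    exact ⟨ν, hν, fun a a' b b' => by rw [h, hp]⟩
  have hw0 : ∀ l k, 0 ≤ w l k := fun l k => (hJ0 k 0 l 0).trans (hJw k 0 l 0)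
  -- One zero of `w` makes `w` vanish whenever both arguments are nonzero. Then `J` matters only
  -- where `a + a' = 0` or `b + b' = 0`, and a product of two one-parameter laws `q` and `r` fits
  -- both.
  by_cases h : ∃ l k, w l k = 0
  · obtain ⟨l, k, hlk⟩ := h
    obtain ⟨q, q0, q1, hq, hJq⟩ := exists_split_mul_eq (j := fun a a' => J a a' 0 0)
      (v := fun k => w 0 k) (fun _ _ => hJ0 _ _ _ _) hJ1 hw1
      (fun a a' => by simpa using hJw a a' 0 0) (fun a a' => by simpa using hx a a' 0 0)
      (fun n m hn hm => hw _ _ _ _ hn id fun _ => hm)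
    obtain ⟨r, r0, r1, hr, hJr⟩ := exists_split_mul_eq (j := fun b b' => J 0 0 b b')
      (v := fun l => w l 0) (fun _ _ => hJ0 _ _ _ _) hJ1 hw1
      (fun b b' => by simpa using hJw 0 0 b b') (fun b b' => by simpa using hy 0 0 b b')
      (fun n m hn hm => hw _ _ _ _ hn (fun _ => hm) id)
    refine ⟨fun a a' b b' => q a a' * r b b', fun _ _ _ _ => mul_nonneg (q0 _ _) (r0 _ _),
      by simp [q1, r1], fun a a' b b' => by beta_reduce; rw [hq, add_mul], fun a a' b b' => by
        beta_reduce; rw [hr, mul_add],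
      fun a a' b b' => ?_⟩
    by_cases ha : a + a' = 0
    · obtain ⟨rfl, rfl⟩ := Nat.add_eq_zero_iff.1 ha
      beta_reduce
      rw [q1, one_mul]
      exact hJr b b'
    by_cases hb : b + b' = 0
    · obtain ⟨rfl, rfl⟩ := Nat.add_eq_zero_iff.1 hb
      beta_reduce
      rw [r1, mul_one]
      exact hJq a a'
    have hz := hw l k _ _ hlk (fun _ => hb) (fun _ => ha)
    rw [hz, zero_mul]
    exact le_antisymm (hz ▸ hJw a a' b b') (hJ0 _ _ _ _)
  · have hne : ∀ l k, w l k ≠ 0 := fun l k hlk => h ⟨l, k, hlk⟩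
    refine ⟨fun a a' b b' => J a a' b b' / w (b + b') (a + a'),
      fun _ _ _ _ => div_nonneg (hJ0 _ _ _ _) (hw0 _ _), by simp [hJ1, hw1],
      fun a a' b b' => ?_, fun a a' b b' => ?_, fun a a' b b' => (mul_div_cancel₀ _ (hne _ _)).symm⟩
    · beta_reduce
      rw [show a + 1 + a' = a + a' + 1 by ring, show a + (a' + 1) = a + a' + 1 by ring, ← add_div,
        div_eq_div_iff (hne _ _) (hne _ _), hx]
      ring
    · beta_reduce
      rw [show b + 1 + b' = b + b' + 1 by ring, show b + (b' + 1) = b + b' + 1 by ring, ← add_div,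
        div_eq_div_iff (hne _ _) (hne _ _), hy]
      ring

/-! ### Binary pairs and the final representation -/

/-- The multiset of pairs with the given numbers of `(0, 1)`, `(0, 0)`, `(1, 1)` and `(1, 0)`. -/
def pairMultiset (a a' b b' : ℕ) : Multiset (Fin 2 × Fin 2) :=
  a • {(0, 1)} + a' • {(0, 0)} + (b • {(1, 1)} + b' • {(1, 0)})

theorem exists_pairMultiset_eq (s : Multiset (Fin 2 × Fin 2)) :
    ∃ a a' b b', pairMultiset a a' b b' = s := by
  induction s using Multiset.induction with
  | empty => exact ⟨0, 0, 0, 0, by simp [pairMultiset]⟩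
  | cons z s ih =>
    obtain ⟨a, a', b, b', rfl⟩ := ih
    obtain ⟨x, y⟩ := z
    fin_cases x <;> fin_cases y
    · exact ⟨a, a' + 1, b, b', by
        dsimp; simp only [pairMultiset, succ_nsmul, ← Multiset.singleton_add]; abel⟩
    · exact ⟨a + 1, a', b, b', by
        dsimp; simp only [pairMultiset, succ_nsmul, ← Multiset.singleton_add]; abel⟩
    · exact ⟨a, a', b, b' + 1, by
        dsimp; simp only [pairMultiset, succ_nsmul, ← Multiset.singleton_add]; abel⟩
    · exact ⟨a, a', b + 1, b', by
        dsimp; simp only [pairMultiset, succ_nsmul, ← Multiset.singleton_add]; abel⟩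

theorem map_fst_pairMultiset (a a' b b' : ℕ) :
    (pairMultiset a a' b b').map Prod.fst = (b + b') • {1} + (a + a') • {0} := by
  simp only [pairMultiset, Multiset.map_add, Multiset.map_nsmul, Multiset.map_singleton, add_nsmul]
  abel

theorem prod_map_pairMultiset (a a' b b' : ℕ) (f : Fin 2 × Fin 2 → ℝ) :
    ((pairMultiset a a' b b').map f).prod =
      f (0, 1) ^ a * f (0, 0) ^ a' * (f (1, 1) ^ b * f (1, 0) ^ b') := by
  simp [pairMultiset, Multiset.map_nsmul, Multiset.prod_nsmul]

theorem mainTheorem3 {Ω : Type*} [MeasurableSpace Ω] (P : Measure Ω) [IsProbabilityMeasure P]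
    (X Y : ℕ → Ω → Fin 2) (hX : ∀ n, Measurable (X n)) (hY : ∀ n, Measurable (Y n))
    (hexch : InfinitelyExchangeable P (fun n ω => (X n ω, Y n ω)))
    (hindep : ∀ n : ℕ, CondIndepGivenDiscrete P
      (fun ω (i : Fin n) => Y i ω) (X n) (fun ω (i : Fin n) => X i ω)) :
    ∃ (μ : Measure unitInterval) (ν : Measure (Fin 2 → unitInterval)),
      IsProbabilityMeasure μ ∧ IsProbabilityMeasure ν ∧
      ∀ (N : ℕ) (x y : Fin N → Fin 2),
        P.real {ω | ∀ n : Fin N, X n ω = x n ∧ Y n ω = y n} =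
          ∫ ψ, ∫ θ, ∏ n : Fin N, bernoulliMass (ψ (x n)) (y n) * bernoulliMass θ (x n) ∂μ ∂ν := by
  have hXe : InfinitelyExchangeable P X := hexch.comp measurable_fst
  let Z : ℕ → Ω → Fin 2 × Fin 2 := fun n ω => (X n ω, Y n ω)
  let w : ℕ → ℕ → ℝ := fun l k => multisetProb P X (l • {1} + k • {0})
  let J : ℕ → ℕ → ℕ → ℕ → ℝ := fun a a' b b' => multisetProb P Z (pairMultiset a a' b b')
  obtain ⟨μ, hμ, hμw⟩ := exists_isProbabilityMeasure_integral_unitInterval_eq (w := w)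
    (fun _ _ => multisetProb_nonneg _ _ _) (by simp [w, multisetProb_zero]) (fun a b => by
      have h := hXe.multisetProb_eq_sum_cons hX (a • {1} + b • {0})
      rw [Fin.sum_univ_two, add_comm (multisetProb _ _ _), ← Multiset.singleton_add, ← Multiset.singleton_add] at h
      simp only [w, succ_nsmul]
      rw [h]
      congr 2 <;> abel)
  have hcons := multisetProb_mul_cons_map_fst hX hY hexch hindep
  obtain ⟨ν, hν, hJ⟩ := exists_measure_eq_mul_integral (J := J) (w := w)
    (fun _ _ _ _ => multisetProb_nonneg _ _ _)
    (by simp [J, pairMultiset, multisetProb_zero]) (by simp [w, multisetProb_zero])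
    (fun a a' b b' => by
      simpa only [map_fst_pairMultiset] using multisetProb_le_map_fst hexch (pairMultiset a a' b b'))
    (fun a a' b b' => by
      have h := hcons (pairMultiset a a' b b') 0
      rw [map_fst_pairMultiset, Fin.sum_univ_two, add_comm (multisetProb _ _ _),
        ← Multiset.singleton_add, ← Multiset.singleton_add, ← Multiset.singleton_add] at h
      convert h using 3
      · rw [succ_nsmul]; abel
      · simp only [J, pairMultiset, succ_nsmul]; congr 1; abel
      · simp only [J, pairMultiset, succ_nsmul]; congr 1; abel)
    (fun a a' b b' => by
      have h := hcons (pairMultiset a a' b b') 1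
      rw [map_fst_pairMultiset, Fin.sum_univ_two, add_comm (multisetProb _ _ _),
        ← Multiset.singleton_add, ← Multiset.singleton_add, ← Multiset.singleton_add] at h
      convert h using 3
      · rw [succ_nsmul]; abel
      · simp only [J, pairMultiset, succ_nsmul]; congr 1; abel
      · simp only [J, pairMultiset, succ_nsmul]; congr 1; abel)
    -- Zeros of `w` propagate because `w` is already known to consist of moments of `μ`.
    (fun a b a' b' h ha hb => by
      rw [← hμw] at h ⊢
      exact integral_pow_mul_pow_eq_zero h ha hb)
  refine ⟨μ, ν, hμ, hν, fun N x y => ?_⟩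
  let z : Fin N → Fin 2 × Fin 2 := fun n => (x n, y n)
  obtain ⟨a, a', b, b', hz⟩ := exists_pairMultiset_eq (List.ofFn z)
  have hP : P.real {ω | ∀ n : Fin N, X n ω = x n ∧ Y n ω = y n} = J a a' b b' := by
    simp only [J, hz]
    rw [← hexch.measureReal_eq_multisetProb z]
    simp [z, Prod.ext_iff]
  have hprod : ∀ f : Fin 2 × Fin 2 → ℝ, ∏ n, f (x n, y n) =
      f (0, 1) ^ a * f (0, 0) ^ a' * (f (1, 1) ^ b * f (1, 0) ^ b') := by
    intro f
    rw [← prod_map_pairMultiset, hz, ← Fin.univ_val_map, Multiset.map_map]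
    rfl
  -- Integrating out `θ` leaves a factor `w` that is constant in `ψ`; this is where the independence
  -- of the parameters appears.
  have hint : ∀ ψ : Fin 2 → unitInterval, ∫ θ, ∏ n : Fin N,
      bernoulliMass (ψ (x n)) (y n) * bernoulliMass θ (x n) ∂μ =
      w (b + b') (a + a') *
        (((ψ 0 : unitInterval) : ℝ) ^ a * (1 - ((ψ 0 : unitInterval) : ℝ)) ^ a' *
          (((ψ 1 : unitInterval) : ℝ) ^ b * (1 - ((ψ 1 : unitInterval) : ℝ)) ^ b')) := by
    intro ψ
    rw [← hμw, ← integral_mul_const]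
    congr 1
    ext θ
    rw [hprod fun z => bernoulliMass (ψ z.1) z.2 * bernoulliMass θ z.1]
    simp only [bernoulliMass, zero_ne_one, if_true, if_false]
    simp only [mul_pow, pow_add]
    ring
  simp_rw [hint]
  rw [integral_const_mul, hP, hJ]
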